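/- Let $\Gamma$ be a finite distance-regular graph of degree $k$ and diameter $D$ with intersection array $A=(b_0,\dots,b_{D-1};c_1,\dots,c_D)$; put $b_D=c_0=0$ and $a_i=k-b_i-c_i$. Let $S$ be a set of $(s+1)$-cliques of $\Gamma$ such that every edge of $\Gamma$ lies in exactly $m$ cliques from $S$, where $m\ge 1$. Let $(T_0,T_1)$ be an $S$-bitrade (a clique bitrade), i.e., a pair of disjoint nonempty sets of vertices such that every clique from $S$ either meets each of $T_0$, $T_1$ in exactly one vertex or meets neither of them (this forces $s\ge 1$). Put $\theta=-k/s$ and define $W^0_{A,\theta},\dots,W^D_{A,\theta}$ by $$W^0_{A,\theta}=1,\qquad W^1_{A,\theta}=\theta,\qquad W^i_{A,\theta}=\frac{(\theta-a_{i-1})W^{i-1}_{A,\theta}-b_{i-2}W^{i-2}_{A,\theta}}{c_i}\quad(2\le i\le D).$$ Assume that $(T_0,T_1)$ meets the weight-distribution bound, i.e., that the function equal to $1$ on $T_0$, to $-1$ on $T_1$ and to $0$ elsewhere has exactly $\sum_{i=0}^{D}|W^i_{A,\theta}|$ nonzeros. Then the subgraph $\Gamma^T$ of $\Gamma$ induced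 by $T_0\cup T_1$ is bipartite and distance-regular. Moreover, for every vertex $x$ of $\Gamma^T$ and every $i\in\{0,\dots,D\}$, the number of vertices at distance $i$ from $x$ in $\Gamma^T$ is $|\Gamma^T_i(x)|=|W^i_{A,\theta}|$. -/

import Mathlib

namespace CliqueBitrade

/-- The `i`-th neighbourhood `Γ_i(C)` of a set `C` of vertices: the vertices whose distance to `C`
is exactly `i`. (`SimpleGraph.edist` is `⊤` between vertices in different components.) -/
def nbhd {V : Type*} (Γ : SimpleGraph V) (i : ℕ) (C : Set V) : Set V :=
  {y | (⨅ x ∈ C, Γ.edist x y) = (i : ℕ∞)}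

/-- The data of an intersection array `(b_0, …, b_{ρ-1}; c_1, …, c_ρ)` in a regular graph of
degree `k`. Values of `b` and `c` at indices above `ρ` carry no meaning and are never used. -/
structure IntersectionArray where
  /-- the degree `k` of the graph -/
  degree : ℕ
  /-- the covering radius `ρ` -/
  radius : ℕ
  b : ℕ → ℕ
  c : ℕ → ℕ

/-- The intersection number `a_i = k - b_i - c_i`. -/
noncomputable def IntersectionArray.a (A : IntersectionArray) (i : ℕ) : ℝ :=
  (A.degree : ℝ) - (A.b i : ℝ) - (A.c i : ℝ)

/-- `Γ` is regular of degree `k`. -/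
def IsRegular {V : Type*} [Finite V] (Γ : SimpleGraph V) (k : ℕ) : Prop :=
  ∀ x, (Γ.neighborSet x).ncard = k

/-- `C` is a completely regular set of the regular graph `Γ`, with intersection array `A`. -/
structure IsCompletelyRegular {V : Type*} [Finite V] (Γ : SimpleGraph V) (A : IntersectionArray)
    (C : Set V) : Prop where
  regular : IsRegular Γ A.degree
  nonempty : (nbhd Γ A.radius C).Nonempty
  empty : nbhd Γ (A.radius + 1) C = ∅
  b_eq : ∀ i ≤ A.radius, ∀ y ∈ nbhd Γ i C, (nbhd Γ (i + 1) C ∩ Γ.neighborSet y).ncard = A.b i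
  c_eq : ∀ i < A.radius, ∀ y ∈ nbhd Γ (i + 1) C,
    (nbhd Γ i C ∩ Γ.neighborSet y).ncard = A.c (i + 1)
  b_last : A.b A.radius = 0
  c_zero : A.c 0 = 0

/-- `Γ` is distance-regular with intersection array `A`: it is connected and every singleton is
completely regular with this same array. In particular `A.radius` is the diameter of `Γ`. -/
def IsDistanceRegularWith {V : Type*} [Finite V] (Γ : SimpleGraph V) (A : IntersectionArray) :
    Prop :=
  Γ.Connected ∧ ∀ x : V, IsCompletelyRegular Γ A {x}

/-- `Γ` is distance-regular. -/
def IsDistanceRegular {V : Type*} [Finite V] (Γ : SimpleGraph V) : Prop :=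
  ∃ A : IntersectionArray, IsDistanceRegularWith Γ A

/-- `(Γ, S)` is a `(k, s, m)` pair: `Γ` is connected and regular of degree `k`, and `S` is a set of
`(s+1)`-cliques such that every edge is included in exactly `m` of them. -/
structure IsKSMPair {V : Type*} [Finite V] (Γ : SimpleGraph V) (S : Set (Finset V))
    (k s m : ℕ) : Prop where
  connected : Γ.Connected
  regular : IsRegular Γ k
  clique : ∀ C ∈ S, Γ.IsNClique (s + 1) C
  edge : ∀ u v, Γ.Adj u v → {C : Finset V | C ∈ S ∧ u ∈ C ∧ v ∈ C}.ncard = m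

/-- `(T₀, T₁)` is an `S`-bitrade (a clique bitrade). -/
structure IsBitrade {V : Type*} [Finite V] (S : Set (Finset V)) (T₀ T₁ : Set V) : Prop where
  disjoint : Disjoint T₀ T₁
  nonempty₀ : T₀.Nonempty
  nonempty₁ : T₁.Nonempty
  meet : ∀ C ∈ S,
    (((C : Set V) ∩ T₀).ncard = 1 ∧ ((C : Set V) ∩ T₁).ncard = 1) ∨
    ((C : Set V) ∩ T₀ = ∅ ∧ (C : Set V) ∩ T₁ = ∅)

/-- The function `f^T` equal to `1` on `T₀`, to `-1` on `T₁` and to `0` elsewhere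
(for disjoint `T₀`, `T₁`). -/
noncomputable def bitradeFun {V : Type*} (T₀ T₁ : Set V) : V → ℝ :=
  T₀.indicator (fun _ => 1) - T₁.indicator (fun _ => 1)

/-- The coefficients `W^i_{A,θ}`, for `0 ≤ i ≤ ρ`. -/
noncomputable def W (A : IntersectionArray) (θ : ℝ) : ℕ → ℝ
  | 0 => 1
  | 1 => θ
  | i + 2 => ((θ - A.a (i + 1)) * W A θ (i + 1) - (A.b i : ℝ) * W A θ i) / (A.c (i + 2) : ℝ)

/-- The function `f` meets the weight-distribution bound for the array `A` and the eigenvalue `θ`: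
it has exactly `∑_{i=0}^{D} |W^i_{A,θ}|` nonzeros. -/
def MeetsWDBound {V : Type*} [Finite V] (A : IntersectionArray) (θ : ℝ) (f : V → ℝ) : Prop :=
  ((Function.support f).ncard : ℝ) = ∑ i ∈ Finset.range (A.radius + 1), |W A θ i|

end CliqueBitrade

namespace CliqueBitrade

/-! ### Radial counts and sphere sums in a distance-regular graph. -/

section
open Finset
open scoped Classical

variable {V : Type*} {Γ : SimpleGraph V}

/-! The bitrade function `f` sums to zero over every clique of `S`, so double counting makes it an
eigenfunction for θ = -k/s (`eigen_of_sum_eq_zero`). Its sum over the sphere of radius i about x is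
then W^i f(x) (`sum_sphere_eq_W`). Summing absolute values over all spheres about a bitrade vertex
gives the weight-distribution bound, and equality forces each sphere to contain exactly |W^i|
bitrade vertices, all of one sign.

The two bitrade vertices of a clique have opposite signs, so they are never equidistant from a
bitrade vertex x. Hence a clique that takes y one step towards x has its other bitrade vertex one
step closer, and Γ^T is isometric in Γ (`dist_induce`). This gives the sphere sizes and the valency
|W^1|.

For the numbers c_i of Γ^T, the radial function u_i = W^i/k_i is also a θ-eigenfunction, so it too
sums to zero over cliques (`sum_eq_zero_of_eigen`). A clique with n > 0 vertices at distance i-1 and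
the rest at distance i therefore satisfies n(u_{i-1} - u_i) = -(s+1)u_i, and it contains just one
bitrade vertex closer than y. Adding over the cliques through y determines c_i of Γ^T
(`card_closer`), as u_i ≠ 0 for attained distances. By bipartiteness, b_i is the valency minus c_i.
-/

theorem mem_nbhd_singleton (h : Γ.Connected) {x y : V} {i : ℕ} :
    y ∈ nbhd Γ i {x} ↔ Γ.dist x y = i := by
  have : nbhd Γ i {x} = {y | Γ.edist x y = (i : ℕ∞)} := by simp [nbhd]
  rw [this, Set.mem_ofPred_eq, ← (h x y).coe_dist_eq_edist, Nat.cast_inj]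

theorem dist_le_of_adj_closed (h : Γ.Connected) {x : V} {n : ℕ}
    (H : ∀ y z, Γ.dist x y = n → Γ.Adj y z → Γ.dist x z ≠ n + 1) (y : V) : Γ.dist x y ≤ n := by
  suffices ∀ u v : V, Γ.Walk u v → Γ.dist x u ≤ n → Γ.dist x v ≤ n by
    obtain ⟨w⟩ := h x y
    exact this x y w (by simp)
  intro u v w
  induction w with
  | nil => exact id
  | @cons a b c hab p ih =>
    intro ha
    apply ih
    have h1 := h.dist_triangle (u := x) (v := a) (w := b)
    rw [SimpleGraph.dist_eq_one_iff_adj.2 hab] at h1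
    by_contra! hb
    exact H a b (by omega) hab (by omega)

theorem dist_le_succ (h : Γ.Connected) (x : V) {y z : V} (hyz : Γ.Adj y z) :
    Γ.dist x z ≤ Γ.dist x y + 1 := by
  have h1 := h.dist_triangle (u := x) (v := y) (w := z)
  rwa [SimpleGraph.dist_eq_one_iff_adj.2 hyz] at h1

variable [Fintype V] {A : IntersectionArray}

theorem ncard_nbhd_inter (h : Γ.Connected) (x y : V) (i : ℕ) :
    (nbhd Γ i {x} ∩ Γ.neighborSet y).ncard = #{z | Γ.Adj y z ∧ Γ.dist x z = i} := by
  rw [← Set.ncard_coe_finset]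
  congr 1
  ext z
  simp [mem_nbhd_singleton h, and_comm]

namespace IsDistanceRegularWith

variable (hΓ : IsDistanceRegularWith Γ A)
include hΓ

theorem dist_le (x y : V) : Γ.dist x y ≤ A.radius := by
  refine dist_le_of_adj_closed hΓ.1 (fun y z _ _ hz => ?_) y
  have := (hΓ.2 x).empty
  rw [Set.eq_empty_iff_forall_notMem] at this
  exact this z ((mem_nbhd_singleton hΓ.1).2 hz)

theorem card_succ (x y : V) :
    #{z | Γ.Adj y z ∧ Γ.dist x z = Γ.dist x y + 1} = A.b (Γ.dist x y) := by
  rw [← ncard_nbhd_inter hΓ.1]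
  exact (hΓ.2 x).b_eq _ (hΓ.dist_le x y) y ((mem_nbhd_singleton hΓ.1).2 rfl)

theorem card_pred (x y : V) :
    #{z | Γ.Adj y z ∧ Γ.dist x z + 1 = Γ.dist x y} = A.c (Γ.dist x y) := by
  rcases hi : Γ.dist x y with _ | i
  · simp [(hΓ.2 x).c_zero]
  · have := hΓ.dist_le x y
    simp only [Nat.add_right_cancel_iff]
    rw [← ncard_nbhd_inter hΓ.1]
    exact (hΓ.2 x).c_eq i (by omega) y ((mem_nbhd_singleton hΓ.1).2 hi)

theorem card_adj (y : V) : #{z | Γ.Adj y z} = A.degree := by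
  rw [← (hΓ.2 y).regular y, ← Set.ncard_coe_finset]
  congr 1
  ext z
  simp

/-- At distance 0 the truncated index in the last term is harmless, since c_0 = 0. -/
theorem sum_adj_radial (h : ℕ → ℝ) (x y : V) :
    ∑ z with Γ.Adj y z, h (Γ.dist x z) =
      A.b (Γ.dist x y) * h (Γ.dist x y + 1) + A.a (Γ.dist x y) * h (Γ.dist x y) +
        A.c (Γ.dist x y) * h (Γ.dist x y - 1) := by
  set i := Γ.dist x y with hi
  have key : ∀ h : ℕ → ℝ, ∑ z with Γ.Adj y z, h (Γ.dist x z) =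
      A.b i * h (i + 1) + #{z | Γ.Adj y z ∧ Γ.dist x z = i} * h i + A.c i * h (i - 1) := by
    intro h
    rw [← hΓ.card_succ, ← hΓ.card_pred, ← hi]
    simp only [← filter_filter, card_eq_sum_ones, Nat.cast_sum, sum_mul, Nat.cast_one, one_mul]
    rw [sum_filter (fun z => Γ.dist x z = i + 1), sum_filter (fun z => Γ.dist x z = i),
      sum_filter (fun z => Γ.dist x z + 1 = i), ← sum_add_distrib, ← sum_add_distrib]
    refine sum_congr rfl fun z hz => ?_
    have h0 := (mem_filter.1 hz).2
    have h1 := dist_le_succ hΓ.1 x h0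
    have h2 := dist_le_succ hΓ.1 x h0.symm
    generalize Γ.dist x z = j at *
    have : j = i + 1 ∨ j = i ∨ j + 1 = i := by omega
    rcases this with h3 | h3 | h3
    · simp [h3]
      omega
    · simp [h3]
    · simp [← h3]
      omega
  -- The constant function recovers a_i as the number of neighbours at the same distance.
  have h1 := key fun _ => 1
  rw [sum_const, hΓ.card_adj] at h1
  rw [key, IntersectionArray.a]
  have : (#{z | Γ.Adj y z ∧ Γ.dist x z = i} : ℝ) = A.degree - A.b i - A.c i := by
    simp at h1
    linarith
  rw [this]

theorem exists_dist_eq (x : V) : ∃ y, Γ.dist x y = A.radius := by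
  obtain ⟨y, hy⟩ := (hΓ.2 x).nonempty
  exact ⟨y, (mem_nbhd_singleton hΓ.1).1 hy⟩

theorem exists_adj_dist (x : V) {i : ℕ} (hi : i < A.radius) :
    ∃ y z, Γ.dist x y = i ∧ Γ.Adj y z ∧ Γ.dist x z = i + 1 := by
  by_contra! H
  obtain ⟨y, hy⟩ := hΓ.exists_dist_eq x
  have := dist_le_of_adj_closed hΓ.1 H y
  omega

theorem b_pos [Nonempty V] {i : ℕ} (hi : i < A.radius) : 0 < A.b i := by
  obtain ⟨y, z, hy, hyz, hz⟩ := hΓ.exists_adj_dist (Classical.arbitrary V) hi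
  rw [← hy, ← hΓ.card_succ, card_pos]
  exact ⟨z, by simp [hyz, hz, hy]⟩

theorem c_pos [Nonempty V] {i : ℕ} (hi : i < A.radius) : 0 < A.c (i + 1) := by
  obtain ⟨y, z, hy, hyz, hz⟩ := hΓ.exists_adj_dist (Classical.arbitrary V) hi
  rw [← hz, ← hΓ.card_pred, card_pos]
  exact ⟨y, by simp [hyz.symm, hz, hy]⟩

/-- The double count behind the weight distribution of an eigenfunction. -/
theorem sum_sphere {f : V → ℝ} {θ : ℝ} (hf : ∀ y, ∑ z with Γ.Adj y z, f z = θ * f y)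
    (x : V) (i : ℕ) :
    θ * ∑ y with Γ.dist x y = i + 1, f y =
      A.b i * (∑ y with Γ.dist x y = i, f y) + A.a (i + 1) * (∑ y with Γ.dist x y = i + 1, f y) +
        A.c (i + 2) * ∑ y with Γ.dist x y = i + 2, f y := by
  have h1 : ∀ z, f z * ∑ y with Γ.Adj z y, (if Γ.dist x y = i + 1 then (1 : ℝ) else 0) =
      A.b i * (if Γ.dist x z = i then f z else 0) +
        A.a (i + 1) * (if Γ.dist x z = i + 1 then f z else 0) +
        A.c (i + 2) * (if Γ.dist x z = i + 2 then f z else 0) := by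
    intro z
    rw [hΓ.sum_adj_radial (fun j => if j = i + 1 then (1 : ℝ) else 0)]
    by_cases h1 : Γ.dist x z = i
    · simp [h1]; ring
    by_cases h2 : Γ.dist x z = i + 1
    · simp [h2]; ring
    by_cases h3 : Γ.dist x z = i + 2
    · simp [h3]; ring
    have h4 : Γ.dist x z - 1 ≠ i + 1 := by omega
    simp [h1, h2, h3, h4]
  simp only [sum_filter _ f, mul_sum]
  rw [← sum_add_distrib, ← sum_add_distrib, ← sum_congr rfl fun z _ => h1 z]
  simp only [mul_sum, sum_filter _ _, mul_ite, mul_one, mul_zero, ← hf]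
  rw [sum_comm]
  refine sum_congr rfl fun y _ => ?_
  split_ifs with h2
  · refine sum_congr rfl fun z _ => ?_
    simp [SimpleGraph.adj_comm]
  · simp

theorem sum_sphere_eq_W [Nonempty V] {f : V → ℝ} {θ : ℝ}
    (hf : ∀ y, ∑ z with Γ.Adj y z, f z = θ * f y) (x : V) :
    ∀ i ≤ A.radius, ∑ y with Γ.dist x y = i, f y = W A θ i * f x
  | 0, _ => by
    have : ({y | Γ.dist x y = 0} : Finset V) = {x} := by
      ext y
      simp [hΓ.1.dist_eq_zero_iff, eq_comm]
    rw [this, sum_singleton, W, one_mul]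
  | 1, _ => by
    simp only [SimpleGraph.dist_eq_one_iff_adj]
    rw [hf, W]
  | i + 2, hi => by
    have h1 := hΓ.sum_sphere hf x i
    rw [sum_sphere_eq_W hf x i (by omega), sum_sphere_eq_W hf x (i + 1) (by omega)] at h1
    have h2 : (A.c (i + 2) : ℝ) ≠ 0 := by exact_mod_cast (hΓ.c_pos (i := i + 1) (by omega)).ne'
    rw [W, div_mul_eq_mul_div, eq_div_iff h2]
    linarith

/-- The sphere beyond the diameter is empty, so the recurrence closes up. This end condition holds
because θ is an eigenvalue, witnessed by `f`. -/
theorem W_boundary [Nonempty V] {f : V → ℝ} {θ : ℝ}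
    (hf : ∀ y, ∑ z with Γ.Adj y z, f z = θ * f y) {x : V} (hx : f x ≠ 0) {i : ℕ}
    (hi : i + 1 = A.radius) : θ * W A θ (i + 1) = A.b i * W A θ i + A.a (i + 1) * W A θ (i + 1) := by
  have h1 := hΓ.sum_sphere hf x i
  rw [hΓ.sum_sphere_eq_W hf x i (by omega), hΓ.sum_sphere_eq_W hf x (i + 1) (by omega),
    sum_eq_zero (s := filter (fun y => Γ.dist x y = i + 2) univ)] at h1
  · apply mul_right_cancel₀ hx
    linarith
  · intro y hy
    have := hΓ.dist_le x y
    simp at hy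
    omega

end IsDistanceRegularWith

/-! ### The standard sequence as a radial eigenfunction. -/

/-- The number of vertices at distance `i` from a vertex, in terms of the intersection array. -/
noncomputable def sphereSize (A : IntersectionArray) : ℕ → ℝ
  | 0 => 1
  | i + 1 => sphereSize A i * A.b i / A.c (i + 1)

/-- The standard sequence `u_i = W^i / k_i`. -/
noncomputable def standardSeq (A : IntersectionArray) (θ : ℝ) (i : ℕ) : ℝ :=
  W A θ i / sphereSize A i

namespace IsDistanceRegularWith

variable (hΓ : IsDistanceRegularWith Γ A)
include hΓ

theorem sphereSize_ne_zero [Nonempty V] : ∀ i ≤ A.radius, sphereSize A i ≠ 0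
  | 0, _ => by simp [sphereSize]
  | i + 1, hi => by
    have h1 := sphereSize_ne_zero i (by omega)
    have h2 := hΓ.b_pos (i := i) (by omega)
    have h3 := hΓ.c_pos (i := i) (by omega)
    rw [sphereSize]
    positivity

/-- Dividing by k_i transposes the recurrence for W, because k_i b_i = k_{i+1} c_{i+1}. The last row
is `W_boundary`. -/
theorem sum_adj_standardSeq [Nonempty V] {f : V → ℝ} {θ : ℝ}
    (hf : ∀ y, ∑ z with Γ.Adj y z, f z = θ * f y) {v : V} (hv : f v ≠ 0)
    (hD : 0 < A.radius) (x y : V) :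
    ∑ z with Γ.Adj y z, standardSeq A θ (Γ.dist x z) = θ * standardSeq A θ (Γ.dist x y) := by
  rw [hΓ.sum_adj_radial]
  have hle := hΓ.dist_le x y
  generalize Γ.dist x y = i at hle ⊢
  have h0 := hΓ.sphereSize_ne_zero i hle
  have hb : i < A.radius →
      A.b i * standardSeq A θ (i + 1) = A.c (i + 1) * W A θ (i + 1) / sphereSize A i := by
    intro hi
    have h2 := (hΓ.b_pos hi).ne'
    have h3 := (hΓ.c_pos hi).ne'
    rw [standardSeq, sphereSize]
    field_simp
  rcases i with _ | i
  -- W^1 = θ is defined without division by c_1, so c_1 = 1 is needed here.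
  · have hc1 : A.c 1 = 1 := by
      obtain ⟨y, z, hy, hyz, hz⟩ := hΓ.exists_adj_dist v hD
      have h1 := hΓ.card_pred v z
      rw [hz, zero_add] at h1
      rw [← h1, card_eq_one]
      refine ⟨v, ?_⟩
      ext w
      simp only [Nat.add_eq_right, hΓ.1.dist_eq_zero_iff, mem_filter, mem_univ, true_and,
        mem_singleton]
      rw [hΓ.1.dist_eq_zero_iff] at hy
      subst hy
      exact ⟨fun h => h.2.symm, fun h => by simp [h, hyz.symm]⟩
    have ha : A.a 0 = 0 := by
      have := hΓ.sum_adj_radial (fun i => if i = 0 then 1 else 0) v v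
      simp [hΓ.1.dist_eq_zero_iff, (hΓ.2 v).c_zero] at this
      exact this.symm
    rw [hb hD, ha, (hΓ.2 v).c_zero, hc1]
    simp [standardSeq, sphereSize, W]
  · have h3 : (A.c (i + 1) : ℝ) ≠ 0 := by exact_mod_cast (hΓ.c_pos (i := i) (by omega)).ne'
    have h2 : (A.b i : ℝ) ≠ 0 := by exact_mod_cast (hΓ.b_pos (i := i) (by omega)).ne'
    have h1 := hΓ.sphereSize_ne_zero i (by omega)
    have hc : A.c (i + 1) * standardSeq A θ i = A.b i * W A θ i / sphereSize A (i + 1) := by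
      rw [standardSeq, sphereSize]
      field_simp
    rw [Nat.add_sub_cancel, hc]
    rcases hle.lt_or_eq with hi | hi
    · rw [hb hi, standardSeq]
      have h4 : (A.c (i + 2) : ℝ) ≠ 0 := by exact_mod_cast (hΓ.c_pos hi).ne'
      have h5 : A.c (i + 2) * W A θ (i + 2) = (θ - A.a (i + 1)) * W A θ (i + 1) - A.b i * W A θ i := by
        rw [W]
        field_simp
      rw [show i + 1 + 1 = i + 2 from rfl, h5]
      field_simp
      ring
    · have h5 := hΓ.W_boundary hf hv hi
      have hb0 : A.b (i + 1) = 0 := hi ▸ (hΓ.2 v).b_last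
      rw [hb0, Nat.cast_zero, zero_mul, zero_add, standardSeq]
      field_simp
      linarith

end IsDistanceRegularWith

end

/-! ### Clique sums and the eigenvalue -k/s. -/

section
open Finset
open scoped Classical

variable {V : Type*} {Γ : SimpleGraph V} [Fintype V] {A : IntersectionArray}
  {S : Set (Finset V)} {k s m : ℕ}

namespace IsKSMPair

variable (hS : IsKSMPair Γ S k s m)
include hS

theorem sum_cliques_erase (h : V → ℝ) (y : V) :
    ∑ C with C ∈ S ∧ y ∈ C, ∑ z ∈ C.erase y, h z = m * ∑ z with Γ.Adj y z, h z := by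
  have h1 : ∀ C : Finset V, ∑ z ∈ C.erase y, h z = ∑ z, if z ∈ C.erase y then h z else 0 := by
    intro C
    rw [sum_ite_mem, univ_inter]
  simp only [h1]
  rw [sum_comm, mul_sum, sum_filter]
  refine sum_congr rfl fun z _ => ?_
  rw [← sum_filter, sum_const, filter_filter, nsmul_eq_mul]
  split_ifs with hz
  · rw [← hS.edge y z hz, ← Set.ncard_coe_finset]
    congr 3
    ext C
    simp [hz.ne', and_assoc]
  · rw [card_eq_zero.2, Nat.cast_zero, zero_mul]
    rw [filter_eq_empty_iff]
    rintro C - ⟨⟨hC, hy⟩, hzC⟩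
    rw [mem_erase] at hzC
    exact hz ((hS.clique C hC).1 hy hzC.2 hzC.1.symm)

theorem card_cliques_mul (y : V) : (#{C | C ∈ S ∧ y ∈ C} : ℝ) * s = m * k := by
  have h1 := hS.sum_cliques_erase (fun _ => 1) y
  have h2 : #{z | Γ.Adj y z} = k := by
    rw [← hS.regular y, ← Set.ncard_coe_finset]
    congr 1
    ext z
    simp
  rw [sum_const, h2, sum_congr rfl (g := fun _ => (s : ℝ))] at h1
  · simpa using h1
  · intro C hC
    obtain ⟨hC, hy⟩ := (mem_filter.1 hC).2
    rw [sum_const, card_erase_of_mem hy, (hS.clique C hC).2]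
    simp

theorem sum_cliques (h : V → ℝ) (y : V) :
    ∑ C with C ∈ S ∧ y ∈ C, ∑ z ∈ C, h z =
      #{C | C ∈ S ∧ y ∈ C} * h y + m * ∑ z with Γ.Adj y z, h z := by
  rw [← hS.sum_cliques_erase, ← nsmul_eq_mul, ← sum_const, ← sum_add_distrib]
  refine sum_congr rfl fun C hC => ?_
  rw [add_sum_erase _ _ (mem_filter.1 hC).2.2]

theorem exists_clique (hm : 0 < m) {y z : V} (h : Γ.Adj y z) : ∃ C ∈ S, y ∈ C ∧ z ∈ C := by
  have h1 := hS.edge y z h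
  obtain ⟨C, hC⟩ := Set.nonempty_of_ncard_ne_zero (h1.symm ▸ hm.ne')
  exact ⟨C, hC⟩

theorem s_pos (hm : 0 < m) {y z : V} (h : Γ.Adj y z) : 0 < s := by
  obtain ⟨C, hC, hy, hz⟩ := hS.exists_clique hm h
  have h1 : 1 < #C := one_lt_card.2 ⟨y, hy, z, hz, h.ne⟩
  rw [(hS.clique C hC).2] at h1
  omega

/-- A function with zero sum over every clique is an eigenfunction for `-k/s`. -/
theorem eigen_of_sum_eq_zero (hm : 0 < m) (hs : 0 < s) {f : V → ℝ}
    (hf : ∀ C ∈ S, ∑ z ∈ C, f z = 0) (y : V) :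
    ∑ z with Γ.Adj y z, f z = -(k : ℝ) / s * f y := by
  have h1 := hS.sum_cliques f y
  have h2 := hS.card_cliques_mul y
  rw [sum_eq_zero fun C hC => hf C (mem_filter.1 hC).2.1] at h1
  have hm' : (m : ℝ) ≠ 0 := by positivity
  field_simp
  apply mul_left_cancel₀ hm'
  linear_combination (-s : ℝ) * h1 - f y * h2

/-- An eigenfunction for `-k/s` has zero sum over every clique. -/
theorem sum_eq_zero_of_eigen (hs : 0 < s) {g : V → ℝ}
    (hg : ∀ y, ∑ z with Γ.Adj y z, g z = -(k : ℝ) / s * g y) {C : Finset V} (hC : C ∈ S) :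
    ∑ z ∈ C, g z = 0 := by
  -- The squares of the clique sums add up to ∑_y g(y) ∑_{C ∋ y} ∑_{z ∈ C} g(z), whose inner double
  -- sum vanishes at this eigenvalue.
  have h1 : ∑ C with C ∈ S, (∑ z ∈ C, g z) ^ 2 = 0 := by
    have h2 : ∀ C : Finset V, (∑ z ∈ C, g z) ^ 2 =
        ∑ y, if y ∈ C then g y * ∑ z ∈ C, g z else 0 := by
      intro C
      rw [sum_ite_mem, univ_inter, ← sum_mul, sq]
    simp only [h2]
    rw [sum_comm]
    refine sum_eq_zero fun y _ => ?_
    rw [← sum_filter, filter_filter, ← mul_sum, hS.sum_cliques, hg]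
    have h3 := hS.card_cliques_mul y
    field_simp
    linear_combination g y ^ 2 * h3
  rw [sum_eq_zero_iff_of_nonneg fun _ _ => sq_nonneg _] at h1
  exact pow_eq_zero_iff two_ne_zero |>.1 (h1 C (by simp [hC]))

end IsKSMPair

/-! ### The bitrade function on cliques. -/

theorem bitradeFun_values {U : Type*} (T₀ T₁ : Set U) (hd : Disjoint T₀ T₁) (x : U) :
    (x ∈ T₀ ∧ x ∉ T₁ ∧ bitradeFun T₀ T₁ x = 1) ∨ (x ∈ T₁ ∧ x ∉ T₀ ∧ bitradeFun T₀ T₁ x = -1) ∨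
      (x ∉ T₀ ∧ x ∉ T₁ ∧ bitradeFun T₀ T₁ x = 0) := by
  by_cases h0 : x ∈ T₀
  · have := Set.disjoint_left.1 hd h0
    simp [bitradeFun, h0, this]
  · by_cases h1 : x ∈ T₁ <;> simp [bitradeFun, h0, h1]

theorem support_bitradeFun {U : Type*} {T₀ T₁ : Set U} (hd : Disjoint T₀ T₁) :
    Function.support (bitradeFun T₀ T₁) = T₀ ∪ T₁ := by
  ext x
  rcases bitradeFun_values T₀ T₁ hd x with h | h | h <;> simp [h]

namespace IsBitrade

variable {T₀ T₁ : Set V} (hT : IsBitrade S T₀ T₁)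
include hT

/-- In a clique, a vertex of the bitrade is matched with exactly one other vertex of the bitrade,
from the opposite part. -/
theorem exists_partner {C : Finset V} (hC : C ∈ S) {y : V} (hy : y ∈ C)
    (hfy : bitradeFun T₀ T₁ y ≠ 0) :
    ∃ y' ∈ C, bitradeFun T₀ T₁ y' = -bitradeFun T₀ T₁ y ∧
      ∀ z ∈ C, bitradeFun T₀ T₁ z ≠ 0 → z = y ∨ z = y' := by
  have hv := bitradeFun_values T₀ T₁ hT.disjoint
  have hy' := hv y
  rcases hT.meet C hC with ⟨h0, h1⟩ | ⟨h0, h1⟩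
  · obtain ⟨u, hu⟩ := Set.ncard_eq_one.1 h0
    obtain ⟨w, hw⟩ := Set.ncard_eq_one.1 h1
    simp only [Set.ext_iff, Set.mem_inter_iff, SetLike.mem_coe, Set.mem_singleton_iff] at hu hw
    have hu' := (hu u).2 rfl
    have hw' := (hw w).2 rfl
    have hfu := hv u
    have hfw := hv w
    rcases hy' with h | h | h
    · have : y = u := (hu y).1 ⟨hy, h.1⟩
      refine ⟨w, hw'.1, ?_, fun z hz hfz => ?_⟩
      · rcases hfw with h' | h' | h' <;> simp_all
      · rcases hv z with h' | h' | h'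
        · exact Or.inl (((hu z).1 ⟨hz, h'.1⟩).trans this.symm)
        · exact Or.inr ((hw z).1 ⟨hz, h'.1⟩)
        · exact absurd h'.2.2 hfz
    · have : y = w := (hw y).1 ⟨hy, h.1⟩
      refine ⟨u, hu'.1, ?_, fun z hz hfz => ?_⟩
      · rcases hfu with h' | h' | h' <;> simp_all
      · rcases hv z with h' | h' | h'
        · exact Or.inr ((hu z).1 ⟨hz, h'.1⟩)
        · exact Or.inl (((hw z).1 ⟨hz, h'.1⟩).trans this.symm)
        · exact absurd h'.2.2 hfz
    · exact absurd h.2.2 hfy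
  · simp only [Set.ext_iff, Set.mem_inter_iff, SetLike.mem_coe, Set.mem_empty_iff_false,
      iff_false, not_and] at h0 h1
    rcases hy' with h | h | h
    · exact absurd h.1 (h0 y hy)
    · exact absurd h.1 (h1 y hy)
    · exact absurd h.2.2 hfy

theorem sum_clique_eq_zero {C : Finset V} (hC : C ∈ S) : ∑ z ∈ C, bitradeFun T₀ T₁ z = 0 := by
  by_cases h : ∃ y ∈ C, bitradeFun T₀ T₁ y ≠ 0
  · obtain ⟨y, hy, hfy⟩ := h
    obtain ⟨y', hy', hfy', hu⟩ := hT.exists_partner hC hy hfy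
    have hne : y ≠ y' := by
      rintro rfl
      apply hfy
      linarith
    rw [← sum_subset (s₁ := {y, y'})]
    · rw [sum_pair hne, hfy', add_neg_cancel]
    · intro z
      simp only [mem_insert, mem_singleton]
      rintro (rfl | rfl) <;> assumption
    · intro z hz hz'
      by_contra hfz
      exact hz' (by simpa using hu z hz hfz)
  · push Not at h
    exact sum_eq_zero h

end IsBitrade

/-! ### Equality in the weight-distribution bound. -/

/-- Tightness of the weight-distribution bound: no cancellation on any sphere. -/
theorem IsDistanceRegularWith.sum_sphere_abs [Nonempty V] (hΓ : IsDistanceRegularWith Γ A)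
    {f : V → ℝ} {θ : ℝ} (hf : ∀ y, ∑ z with Γ.Adj y z, f z = θ * f y)
    (hval : ∀ y, f y ≠ 0 → |f y| = 1) (hwd : MeetsWDBound A θ f) {x : V} (hx : f x ≠ 0)
    {i : ℕ} (hi : i ≤ A.radius) :
    ∑ y with Γ.dist x y = i, |f y| = |W A θ i| := by
  have h1 : ∀ j ∈ range (A.radius + 1),
      |W A θ j| ≤ ∑ y with Γ.dist x y = j, |f y| := by
    intro j hj
    have h2 := hΓ.sum_sphere_eq_W hf x j (Nat.lt_succ_iff.1 (mem_range.1 hj))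
    have h3 := congrArg abs h2
    rw [abs_mul, hval x hx, mul_one] at h3
    rw [← h3]
    exact abs_sum_le_sum_abs _ _
  have h2 : ∑ j ∈ range (A.radius + 1), ∑ y with Γ.dist x y = j, |f y| = ∑ y, |f y| :=
    sum_fiberwise_of_maps_to
      (fun y _ => mem_range.2 (Nat.lt_succ_iff.2 (hΓ.dist_le x y))) _
  have h3 : ∑ y, |f y| = (Function.support f).ncard := by
    have : Function.support f = (({y | f y ≠ 0} : Finset V) : Set V) := by
      ext y
      simp
    rw [this, Set.ncard_coe_finset, card_eq_sum_ones, Nat.cast_sum, sum_filter]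
    refine sum_congr rfl fun y _ => ?_
    split_ifs with hy
    · simpa using hval y hy
    · simpa using hy
  rw [hwd, ← h2] at h3
  exact ((sum_eq_sum_iff_of_le h1).1 h3.symm i (mem_range.2 (Nat.lt_succ_iff.2 hi))).symm

/-- Equality in the triangle inequality gives all nonzero terms the same sign. -/
theorem eq_of_abs_sum_eq {ι : Type*} {B : Finset ι} {f : ι → ℝ}
    (h : |∑ i ∈ B, f i| = ∑ i ∈ B, |f i|) (hval : ∀ i ∈ B, f i ≠ 0 → |f i| = 1)
    {i j : ι} (hi : i ∈ B) (hj : j ∈ B) (hfi : f i ≠ 0) (hfj : f j ≠ 0) : f i = f j := by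
  rcases abs_choice (∑ i ∈ B, f i) with h1 | h1
  · rw [h1] at h
    have h2 := (sum_eq_sum_iff_of_le fun i _ => le_abs_self (f i)).1 h
    rw [h2 i hi, h2 j hj, hval i hi hfi, hval j hj hfj]
  · rw [h1, ← sum_neg_distrib] at h
    have h2 := (sum_eq_sum_iff_of_le fun i _ => neg_le_abs (f i)).1 h
    apply neg_injective
    rw [h2 i hi, h2 j hj, hval i hi hfi, hval j hj hfj]

end

/-! ### Distance-regularity from counts that depend only on distance. -/

theorem isDistanceRegular_of_ncard {U : Type*} [Finite U] {G : SimpleGraph U} (h : G.Connected)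
    {D : ℕ} (hle : ∀ x y, G.dist x y ≤ D) (hex : ∀ x, ∃ y, G.dist x y = D)
    (hb : ∀ x y x' y', G.dist x y = G.dist x' y' →
      {z | G.Adj y z ∧ G.dist x z = G.dist x y + 1}.ncard =
        {z | G.Adj y' z ∧ G.dist x' z = G.dist x' y' + 1}.ncard)
    (hc : ∀ x y x' y', G.dist x y = G.dist x' y' →
      {z | G.Adj y z ∧ G.dist x z + 1 = G.dist x y}.ncard =
        {z | G.Adj y' z ∧ G.dist x' z + 1 = G.dist x' y'}.ncard) :
    IsDistanceRegular G := by
  obtain ⟨β, hβ⟩ := (Function.factorsThrough_iff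
    (g := fun p : U × U => {z | G.Adj p.2 z ∧ G.dist p.1 z = G.dist p.1 p.2 + 1}.ncard)
    (f := fun p : U × U => G.dist p.1 p.2)).1 fun p q hpq => hb p.1 p.2 q.1 q.2 hpq
  obtain ⟨γ, hγ⟩ := (Function.factorsThrough_iff
    (g := fun p : U × U => {z | G.Adj p.2 z ∧ G.dist p.1 z + 1 = G.dist p.1 p.2}.ncard)
    (f := fun p : U × U => G.dist p.1 p.2)).1 fun p q hpq => hc p.1 p.2 q.1 q.2 hpq
  replace hβ : ∀ x y, {z | G.Adj y z ∧ G.dist x z = G.dist x y + 1}.ncard = β (G.dist x y) :=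
    fun x y => congrFun hβ (x, y)
  replace hγ : ∀ x y, {z | G.Adj y z ∧ G.dist x z + 1 = G.dist x y}.ncard = γ (G.dist x y) :=
    fun x y => congrFun hγ (x, y)
  have hset : ∀ x y i, nbhd G i {x} ∩ G.neighborSet y = {z | G.Adj y z ∧ G.dist x z = i} := by
    intro x y i
    ext z
    simp [mem_nbhd_singleton h, and_comm]
  refine ⟨⟨β 0, D, β, γ⟩, h, fun x => ⟨fun y => ?_, ?_, ?_, ?_, ?_, ?_, ?_⟩⟩
  · have h1 := hβ y y
    rw [SimpleGraph.dist_self] at h1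
    rw [← h1]
    congr 1
    ext z
    simp
  · obtain ⟨y, hy⟩ := hex x
    exact ⟨y, (mem_nbhd_singleton h).2 hy⟩
  · refine Set.eq_empty_of_forall_notMem fun y hy => ?_
    have h1 := (mem_nbhd_singleton h).1 hy
    have h2 := hle x y
    simp only at h1
    omega
  · intro i _ y hy
    rw [mem_nbhd_singleton h] at hy
    rw [hset, ← hy, hβ]
  · intro i _ y hy
    rw [mem_nbhd_singleton h] at hy
    change _ = γ (i + 1)
    rw [hset, ← hy, ← hγ, hy]
    simp only [Nat.add_right_cancel_iff]
  · obtain ⟨y, hy⟩ := hex x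
    change β D = 0
    rw [← hy, ← hβ, Set.ncard_eq_zero]
    refine Set.eq_empty_of_forall_notMem fun z hz => ?_
    have h2 := hle x z
    have h3 := hz.2
    omega
  · change γ 0 = 0
    have h1 := hγ x x
    rw [SimpleGraph.dist_self] at h1
    simp [← h1]

/-! ### The subgraph induced by the bitrade. -/

section
open Finset
open scoped Classical

variable {V : Type*} {Γ : SimpleGraph V} [Fintype V] {A : IntersectionArray}
  {S : Set (Finset V)} {k s m : ℕ} {T₀ T₁ : Set V}

theorem IsBitrade.eq_neg_of_adj (hT : IsBitrade S T₀ T₁) (hS : IsKSMPair Γ S k s m) (hm : 0 < m)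
    {y z : V} (hyz : Γ.Adj y z) (hy : bitradeFun T₀ T₁ y ≠ 0) (hz : bitradeFun T₀ T₁ z ≠ 0) :
    bitradeFun T₀ T₁ z = -bitradeFun T₀ T₁ y := by
  obtain ⟨C, hC, hyC, hzC⟩ := hS.exists_clique hm hyz
  obtain ⟨y', _, hfy', hu⟩ := hT.exists_partner hC hyC hy
  rcases hu z hzC hz with rfl | rfl
  · exact absurd hyz (SimpleGraph.irrefl _)
  · exact hfy'

theorem IsBitrade.isBipartite_induce (hT : IsBitrade S T₀ T₁) (hS : IsKSMPair Γ S k s m)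
    (hm : 0 < m) : (Γ.induce (T₀ ∪ T₁)).IsBipartite := by
  refine ⟨SimpleGraph.Coloring.mk (fun x => if (x : V) ∈ T₀ then 0 else 1) ?_⟩
  rintro ⟨x, hx⟩ ⟨y, hy⟩ hxy
  rw [← support_bitradeFun hT.disjoint, Function.mem_support] at hx hy
  have h1 := hT.eq_neg_of_adj hS hm hxy hx hy
  rcases bitradeFun_values T₀ T₁ hT.disjoint x with h | h | h <;>
  rcases bitradeFun_values T₀ T₁ hT.disjoint y with h' | h' | h' <;>
  simp [h, h'] at hx hy h1 ⊢ <;> norm_num at h1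

theorem IsKSMPair.dist_le_of_mem (hS : IsKSMPair Γ S k s m) {C : Finset V} (hC : C ∈ S) {y z : V}
    (hy : y ∈ C) (hz : z ∈ C) (x : V) : Γ.dist x z ≤ Γ.dist x y + 1 := by
  by_cases h : y = z
  · simp [h]
  · exact dist_le_succ hS.connected x ((hS.clique C hC).1 hy hz h)

/-- The values of the bitrade function do not change sign on a sphere about a vertex of the
bitrade. -/
def SphereSigned (Γ : SimpleGraph V) (f : V → ℝ) : Prop :=
  ∀ ⦃x y z⦄, f x ≠ 0 → f y ≠ 0 → f z ≠ 0 → Γ.dist x y = Γ.dist x z → f y = f z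

/-- If a clique contains a bitrade vertex `y` and some vertex closer to `x` than `y`, then
the partner of `y` in the clique is closer to `x` than `y`. -/
theorem IsBitrade.exists_partner_closer (hT : IsBitrade S T₀ T₁) (hS : IsKSMPair Γ S k s m)
    (hsg : SphereSigned Γ (bitradeFun T₀ T₁)) {C : Finset V} (hC : C ∈ S) {x y z : V}
    (hx : bitradeFun T₀ T₁ x ≠ 0) (hy : bitradeFun T₀ T₁ y ≠ 0) (hyC : y ∈ C) (hzC : z ∈ C)
    (hz : Γ.dist x z + 1 = Γ.dist x y) :
    ∃ y' ∈ C, bitradeFun T₀ T₁ y' ≠ 0 ∧ Γ.dist x y' + 1 = Γ.dist x y ∧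
      ∀ w ∈ C, bitradeFun T₀ T₁ w ≠ 0 → w = y ∨ w = y' := by
  obtain ⟨y', hyC', hfy', hu⟩ := hT.exists_partner hC hyC hy
  have hne : bitradeFun T₀ T₁ y' ≠ 0 := by rwa [hfy', neg_ne_zero]
  refine ⟨y', hyC', hne, ?_, hu⟩
  -- Equidistant bitrade vertices have the same sign, but partners have opposite signs.
  have h1 : Γ.dist x y' ≠ Γ.dist x y := by
    intro h
    have := hsg hx hne hy h
    apply hy
    linarith
  have h2 := hS.dist_le_of_mem hC hzC hyC' x
  have h3 := hS.dist_le_of_mem hC hyC' hyC x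
  omega

/-- The first edge of a geodesic of Γ from y to x lies in a clique of `S`. The partner of y there is
one step closer to x and replaces the geodesic's next vertex. -/
theorem IsBitrade.exists_walk_induce (hT : IsBitrade S T₀ T₁) (hS : IsKSMPair Γ S k s m)
    (hm : 0 < m) (hsg : SphereSigned Γ (bitradeFun T₀ T₁)) (x : ↥(T₀ ∪ T₁)) :
    ∀ (n : ℕ) (y : ↥(T₀ ∪ T₁)), Γ.dist x y = n →
      ∃ w : (Γ.induce (T₀ ∪ T₁)).Walk y x, w.length = n
  | 0, y, h => by
    rw [hS.connected.dist_eq_zero_iff, Subtype.coe_inj] at h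
    subst h
    exact ⟨.nil, rfl⟩
  | n + 1, y, h => by
    have hsupp : ∀ z : V, z ∈ T₀ ∪ T₁ ↔ bitradeFun T₀ T₁ z ≠ 0 := fun z => by
      rw [← support_bitradeFun hT.disjoint, Function.mem_support]
    obtain ⟨w, hw⟩ := hS.connected.exists_walk_length_eq_dist y.1 x.1
    rw [SimpleGraph.dist_comm, h] at hw
    have hne : y.1 ≠ x.1 := fun h' => by simp [h'] at h
    obtain ⟨z, hyz, p, rfl⟩ := SimpleGraph.Walk.exists_eq_cons_of_ne hne w
    have hp := SimpleGraph.dist_le p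
    rw [SimpleGraph.dist_comm] at hp
    have h1 := dist_le_succ hS.connected x.1 hyz.symm
    rw [SimpleGraph.Walk.length_cons] at hw
    obtain ⟨C, hC, hyC, hzC⟩ := hS.exists_clique hm hyz
    obtain ⟨y', hyC', hne, hd, -⟩ := hT.exists_partner_closer hS hsg hC ((hsupp _).1 x.2)
      ((hsupp _).1 y.2) hyC hzC (by omega)
    have hyy' : y.1 ≠ y' := by
      rintro rfl
      omega
    obtain ⟨w', hw'⟩ := exists_walk_induce hT hS hm hsg x n ⟨y', (hsupp _).2 hne⟩
      (by simp only; omega)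
    have hadj : (Γ.induce (T₀ ∪ T₁)).Adj y ⟨y', (hsupp _).2 hne⟩ :=
      (hS.clique C hC).1 hyC hyC' hyy'
    exact ⟨.cons hadj w', by simp [hw']⟩

theorem IsBitrade.connected_induce (hT : IsBitrade S T₀ T₁) (hS : IsKSMPair Γ S k s m)
    (hm : 0 < m) (hsg : SphereSigned Γ (bitradeFun T₀ T₁)) :
    (Γ.induce (T₀ ∪ T₁)).Connected := by
  obtain ⟨x, hx⟩ := hT.nonempty₀
  have : Nonempty ↥(T₀ ∪ T₁) := ⟨⟨x, Or.inl hx⟩⟩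
  refine ⟨fun y z => ?_⟩
  obtain ⟨w, -⟩ := hT.exists_walk_induce hS hm hsg z _ y rfl
  exact ⟨w⟩

/-- The subgraph induced by the bitrade is isometric. -/
theorem IsBitrade.dist_induce (hT : IsBitrade S T₀ T₁) (hS : IsKSMPair Γ S k s m)
    (hm : 0 < m) (hsg : SphereSigned Γ (bitradeFun T₀ T₁)) (x y : ↥(T₀ ∪ T₁)) :
    (Γ.induce (T₀ ∪ T₁)).dist x y = Γ.dist x y := by
  apply le_antisymm
  · obtain ⟨w, hw⟩ := hT.exists_walk_induce hS hm hsg x _ y rfl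
    rw [← hw, SimpleGraph.dist_comm]
    exact SimpleGraph.dist_le w
  · obtain ⟨w, hw⟩ := (hT.connected_induce hS hm hsg).exists_walk_length_eq_dist x y
    rw [← hw, ← SimpleGraph.Walk.length_map (SimpleGraph.Embedding.induce (T₀ ∪ T₁)).toHom w]
    exact SimpleGraph.dist_le _

/-- The number of neighbours of `y` in the bitrade that are closer to `x` is determined by the
distance from `x` to `y`. -/
theorem IsBitrade.card_closer (hT : IsBitrade S T₀ T₁) (hS : IsKSMPair Γ S k s m)
    (hm : 0 < m) (hsg : SphereSigned Γ (bitradeFun T₀ T₁)) (hΓ : IsDistanceRegularWith Γ A)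
    {u : ℕ → ℝ} {x y : V} (hu : ∀ C ∈ S, ∑ z ∈ C, u (Γ.dist x z) = 0)
    (hx : bitradeFun T₀ T₁ x ≠ 0) (hy : bitradeFun T₀ T₁ y ≠ 0) :
    (#{z | Γ.Adj y z ∧ bitradeFun T₀ T₁ z ≠ 0 ∧ Γ.dist x z + 1 = Γ.dist x y} : ℝ) *
        ((s + 1) * u (Γ.dist x y)) =
      -(A.c (Γ.dist x y) * (u (Γ.dist x y - 1) - u (Γ.dist x y))) := by
  set i := Γ.dist x y with hi
  let h₁ : V → ℝ := fun z => if Γ.dist x z + 1 = i then 1 else 0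
  let h₂ : V → ℝ := fun z => if bitradeFun T₀ T₁ z ≠ 0 ∧ Γ.dist x z + 1 = i then 1 else 0
  -- Per clique, `h₁` counts all vertices one step closer to x and `h₂` only those in the bitrade.
  -- The latter count is 1 or, if no vertex is closer, both counts are 0.
  have key : ∀ C ∈ ({C | C ∈ S ∧ y ∈ C} : Finset (Finset V)),
      (∑ z ∈ C, h₁ z) * (u (i - 1) - u i) = -((s + 1) * u i) * ∑ z ∈ C, h₂ z := by
    intro C hC
    obtain ⟨hC, hyC⟩ := (mem_filter.1 hC).2
    by_cases hex : ∃ z ∈ C, Γ.dist x z + 1 = i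
    · obtain ⟨z, hzC, hz⟩ := hex
      obtain ⟨y', hyC', hne, hd, huniq⟩ := hT.exists_partner_closer hS hsg hC hx hy hyC hzC hz
      have h2 : ∑ z ∈ C, h₂ z = 1 := by
        rw [sum_eq_single_of_mem y' hyC']
        · exact if_pos ⟨hne, hd⟩
        · intro w hw hwy
          refine if_neg fun hw' => ?_
          rcases huniq w hw hw'.1 with rfl | h
          · omega
          · exact hwy h
      have h1 : ∀ w ∈ C, u (Γ.dist x w) = u i + h₁ w * (u (i - 1) - u i) := by
        intro w hw
        have h3 := hS.dist_le_of_mem hC hzC hw x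
        have h4 := hS.dist_le_of_mem hC hw hyC x
        by_cases h5 : Γ.dist x w + 1 = i
        · simp only [h₁, if_pos h5]
          rw [show Γ.dist x w = i - 1 by omega]
          ring
        · simp only [h₁, if_neg h5]
          rw [show Γ.dist x w = i by omega]
          ring
      have h3 := hu C hC
      rw [sum_congr rfl h1, sum_add_distrib, sum_const, (hS.clique C hC).2, ← sum_mul] at h3
      rw [h2]
      push_cast [nsmul_eq_mul] at h3
      linarith
    · push Not at hex
      rw [sum_eq_zero fun z hz => if_neg (hex z hz),
        sum_eq_zero fun z hz => if_neg fun h => hex z hz h.2]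
      simp
  have h1 := hS.sum_cliques h₁ y
  have h2 := hS.sum_cliques h₂ y
  have h3 := sum_congr rfl key
  have h4 : h₁ y = 0 := if_neg (by omega)
  have h5 : h₂ y = 0 := if_neg (by omega)
  have h6 : ∑ z with Γ.Adj y z, h₁ z = A.c i := by
    rw [hi, ← hΓ.card_pred, sum_boole, filter_filter]
  have h7 : ∑ z with Γ.Adj y z, h₂ z =
      #{z | Γ.Adj y z ∧ bitradeFun T₀ T₁ z ≠ 0 ∧ Γ.dist x z + 1 = i} := by
    rw [sum_boole, filter_filter]
  rw [← sum_mul, ← mul_sum, h1, h2, h4, h5, h6, h7] at h3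
  have hm' : (m : ℝ) ≠ 0 := by positivity
  apply mul_left_cancel₀ hm'
  linarith

theorem ncard_subtype {T : Set V} (p : V → Prop) :
    {z : T | p z}.ncard = #{z | z ∈ T ∧ p z} := by
  rw [← Set.ncard_image_of_injective _ Subtype.val_injective, ← Set.ncard_coe_finset]
  congr 1
  ext z
  simp [and_comm]

theorem MeetsWDBound.induce_isDistanceRegular (hΓ : IsDistanceRegularWith Γ A)
    (hS : IsKSMPair Γ S k s m) (hm : 0 < m) (hT : IsBitrade S T₀ T₁)
    (hwd : MeetsWDBound A (-(k : ℝ) / (s : ℝ)) (bitradeFun T₀ T₁)) :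
    IsDistanceRegular (Γ.induce (T₀ ∪ T₁)) ∧ ∀ (x : ↥(T₀ ∪ T₁)) (i : ℕ), i ≤ A.radius →
      ((nbhd (Γ.induce (T₀ ∪ T₁)) i {x}).ncard : ℝ) = |W A (-(k : ℝ) / (s : ℝ)) i| := by

  obtain ⟨x₀, hx₀⟩ := hT.nonempty₀
  obtain ⟨x₁, hx₁⟩ := hT.nonempty₁
  have : Nonempty V := ⟨x₀⟩
  set f := bitradeFun T₀ T₁ with hfdef
  set θ := -(k : ℝ) / (s : ℝ)
  have hsupp : ∀ z : V, z ∈ T₀ ∪ T₁ ↔ f z ≠ 0 := fun z => by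
    rw [← support_bitradeFun hT.disjoint, Function.mem_support]
  have hne : x₀ ≠ x₁ := fun h => Set.disjoint_left.1 hT.disjoint hx₀ (h ▸ hx₁)
  have hD : 0 < A.radius := (hΓ.1.pos_dist_of_ne hne).trans_le (hΓ.dist_le x₀ x₁)
  have hs : 0 < s := by
    obtain ⟨y, z, -, hyz, -⟩ := hΓ.exists_adj_dist x₀ hD
    exact hS.s_pos hm hyz
  have hf := hS.eigen_of_sum_eq_zero hm hs fun C hC => hT.sum_clique_eq_zero hC
  have hval : ∀ y, f y ≠ 0 → |f y| = 1 := by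
    intro y hy
    rcases bitradeFun_values T₀ T₁ hT.disjoint y with h | h | h
    · simp [hfdef, h]
    · simp [hfdef, h]
    · exact absurd h.2.2 hy
  have habs : ∀ x, f x ≠ 0 → ∀ i ≤ A.radius,
      ∑ y with Γ.dist x y = i, |f y| = |W A θ i| := by
    intro x hx i hi
    exact hΓ.sum_sphere_abs hf hval hwd hx hi
  have hsg : SphereSigned Γ f := by
    intro x y z hx hy hz hyz
    have h1 := hΓ.sum_sphere_eq_W hf x _ (hΓ.dist_le x y)
    have h2 := congrArg abs h1
    rw [abs_mul, hval x hx, mul_one, ← habs x hx _ (hΓ.dist_le x y)] at h2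
    exact eq_of_abs_sum_eq h2 (fun i _ => hval i) (by simp) (by simp [hyz]) hy hz
  have hconn := hT.connected_induce hS hm hsg
  have hdist := hT.dist_induce hS hm hsg
  set G := Γ.induce (T₀ ∪ T₁)
  have hsphere : ∀ (x : ↥(T₀ ∪ T₁)) (i : ℕ), i ≤ A.radius →
      ({y | G.dist x y = i}.ncard : ℝ) = |W A θ i| := by
    intro x i hi
    simp only [hdist]
    rw [ncard_subtype fun y => Γ.dist x y = i, ← habs x ((hsupp x).1 x.2) i hi, card_eq_sum_ones,
      Nat.cast_sum, sum_filter, sum_filter]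
    refine sum_congr rfl fun y _ => ?_
    simp only [hsupp]
    by_cases h1 : f y = 0
    · simp [h1]
    · simp [h1, hval y h1]
  have hdeg : ∀ y : ↥(T₀ ∪ T₁), ({z | G.Adj y z}.ncard : ℝ) = |W A θ 1| := by
    intro y
    rw [← hsphere y 1 hD]
    simp only [SimpleGraph.dist_eq_one_iff_adj]
  have hW : ∀ x y : ↥(T₀ ∪ T₁), W A θ (G.dist x y) ≠ 0 := by
    intro x y
    have h1 := hsphere x (G.dist x y) (hdist x y ▸ hΓ.dist_le _ _)
    -- |W^i| is the size of a sphere that contains y.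
    rw [← abs_ne_zero, ← h1, Nat.cast_ne_zero]
    exact Set.ncard_ne_zero_of_mem (a := y) rfl
  have hc : ∀ x y x' y' : ↥(T₀ ∪ T₁), G.dist x y = G.dist x' y' →
      {z | G.Adj y z ∧ G.dist x z + 1 = G.dist x y}.ncard =
        {z | G.Adj y' z ∧ G.dist x' z + 1 = G.dist x' y'}.ncard := by
    have hcount : ∀ x y : ↥(T₀ ∪ T₁),
        ({z | G.Adj y z ∧ G.dist x z + 1 = G.dist x y}.ncard : ℝ) *
          ((s + 1) * standardSeq A θ (G.dist x y)) = -(A.c (G.dist x y) *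
            (standardSeq A θ (G.dist x y - 1) - standardSeq A θ (G.dist x y))) := by
      intro x y
      have hu : ∀ C ∈ S, ∑ z ∈ C, standardSeq A θ (Γ.dist x z) = 0 := fun C hC =>
        hS.sum_eq_zero_of_eigen hs
          (hΓ.sum_adj_standardSeq hf ((hsupp x).1 x.2) hD x) hC
      have h1 := hT.card_closer hS hm hsg hΓ hu ((hsupp x).1 x.2) ((hsupp y).1 y.2)
      simp only [hdist]
      rw [← h1]
      congr 2
      rw [show {z : ↥(T₀ ∪ T₁) | G.Adj y z ∧ Γ.dist x z + 1 = Γ.dist x y} =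
        {z : ↥(T₀ ∪ T₁) | Γ.Adj y z ∧ Γ.dist x z + 1 = Γ.dist x y} from rfl,
        ncard_subtype fun z => Γ.Adj y z ∧ Γ.dist x z + 1 = Γ.dist x y]
      congr 1
      ext z
      simp only [hsupp, mem_filter]
      tauto
    intro x y x' y' h
    have h1 := hcount x y
    have h2 := hcount x' y'
    rw [← h, ← h1] at h2
    have h3 : ((s : ℝ) + 1) * standardSeq A θ (G.dist x y) ≠ 0 := by
      refine mul_ne_zero (by positivity) (div_ne_zero (hW x y) ?_)
      exact hΓ.sphereSize_ne_zero _ (hdist x y ▸ hΓ.dist_le _ _)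
    have h4 := mul_right_cancel₀ h3 h2
    rw [← h]
    exact_mod_cast h4.symm
  have hsum : ∀ x y : ↥(T₀ ∪ T₁), {z | G.Adj y z ∧ G.dist x z + 1 = G.dist x y}.ncard +
      {z | G.Adj y z ∧ G.dist x z = G.dist x y + 1}.ncard = {z | G.Adj y z}.ncard := by
    intro x y
    rw [← Set.ncard_union_eq]
    · congr 1
      ext z
      simp only [Set.mem_union, Set.mem_ofPred_eq]
      refine ⟨fun h => h.elim And.left And.left, fun h => ?_⟩
      have h1 := dist_le_succ hconn x h
      have h2 := dist_le_succ hconn x h.symm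
      have h3 : G.dist x y ≠ G.dist x z := by
        intro h3
        rw [hdist, hdist] at h3
        have hy := (hsupp y).1 y.2
        have hz := (hsupp z).1 z.2
        have h4 := hsg ((hsupp x).1 x.2) hy hz h3
        have h5 := hT.eq_neg_of_adj hS hm (show Γ.Adj y z from h) hy hz
        apply hy
        linarith
      by_cases h4 : G.dist x z + 1 = G.dist x y
      · exact Or.inl ⟨h, h4⟩
      · exact Or.inr ⟨h, by omega⟩
    · rw [Set.disjoint_left]
      rintro z ⟨_, h1⟩ ⟨_, h2⟩
      omega
  refine ⟨?_, fun x i hi => ?_⟩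
  · have : Nonempty ↥(T₀ ∪ T₁) := hconn.nonempty
    -- The diameter is the largest distance attained, not `A.radius` by fiat. Every vertex attains
    -- it, since sphere sizes do not depend on the centre.
    obtain ⟨⟨p, q⟩, hpq⟩ := Finite.exists_max fun p : ↥(T₀ ∪ T₁) × ↥(T₀ ∪ T₁) => G.dist p.1 p.2
    refine isDistanceRegular_of_ncard hconn (fun x y => hpq (x, y)) (fun x => ?_)
      (fun x y x' y' h => ?_) hc
    · have h1 := hsphere x (G.dist p q) (hdist p q ▸ hΓ.dist_le _ _)
      refine Set.nonempty_of_ncard_ne_zero (s := {y | G.dist x y = G.dist p q}) fun h0 => hW p q ?_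
      rw [h0, Nat.cast_zero] at h1
      exact abs_eq_zero.1 h1.symm
    · have h1 := hsum x y
      have h2 := hsum x' y'
      have h3 : {z | G.Adj y z}.ncard = {z | G.Adj y' z}.ncard := by
        exact_mod_cast (hdeg y).trans (hdeg y').symm
      have h4 := hc x y x' y' h
      omega
  · rw [← hsphere x i hi]
    congr 2
    ext y
    exact mem_nbhd_singleton hconn

end

end CliqueBitrade

theorem mainTheorem3 {V : Type*} [Finite V] (Γ : SimpleGraph V)
    (A : CliqueBitrade.IntersectionArray) (hΓ : CliqueBitrade.IsDistanceRegularWith Γ A)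
    (S : Set (Finset V)) (k s m : ℕ) (hm : 0 < m) (hS : CliqueBitrade.IsKSMPair Γ S k s m)
    (T₀ T₁ : Set V) (hT : CliqueBitrade.IsBitrade S T₀ T₁)
    (hwd : CliqueBitrade.MeetsWDBound A (-(k : ℝ) / (s : ℝ)) (CliqueBitrade.bitradeFun T₀ T₁)) :
    (Γ.induce (T₀ ∪ T₁)).IsBipartite ∧
    CliqueBitrade.IsDistanceRegular (Γ.induce (T₀ ∪ T₁)) ∧
    ∀ (x : ↥(T₀ ∪ T₁)) (i : ℕ), i ≤ A.radius →
      ((CliqueBitrade.nbhd (Γ.induce (T₀ ∪ T₁)) i {x}).ncard : ℝ) =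
        |CliqueBitrade.W A (-(k : ℝ) / (s : ℝ)) i| := by
  cases nonempty_fintype V
  exact ⟨hT.isBipartite_induce hS hm, hwd.induce_isDistanceRegular hΓ hS hm hT⟩
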